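/- Let $P_{10}$ be the graph with vertices $a_1,a_2,b_1,b_2,c_1,c_2,d_1,d_2,g_1,g_2$ and the twelve edges $a_1b_1$, $b_1d_2$, $d_2d_1$, $d_1b_2$, $b_2a_2$, $a_1g_1$, $g_1d_1$, $g_1c_1$, $c_1c_2$, $c_2g_2$, $g_2a_2$, $d_2g_2$. Let $D=(G,\mathcal{O},w)$ be a weighted oriented graph with underlying graph $G=P_{10}$, that is, $\mathcal{O}$ gives each edge of $G$ exactly one direction and $w$ assigns to each vertex an integer $w(x)\ge 1$; write $E(D)$ for the set of oriented edges, $N_D^+(x)=\{y : (x,y)\in E(D)\}$, and $V^+=\{x : w(x)>1\}$. Assume that $w(x)=1$ whenever $x$ is a source (a vertex with no incoming edge). Let $K$ be a field and let $$I(D)=\bigl(x\,y^{w(y)} : (x,y)\in E(D)\bigr)$$ be the edge ideal of $D$ in the polynomial ring over $K$ whose variables are the vertices of $D$. Call an ideal unmixed if all its associated primes have the same height, and call a vertex $x$ a sink if $N_D^+(x)=\emptyset$. Then the following are equivalent: 1. $I(D)$ is unmixed. 2. For every $y\in V^+$ that is not a sink, either $y=d_1$ and $N_D^+(y)=\{g_1,b_2\}$,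 or $y=d_2$ and $N_D^+(y)=\{g_2,b_1\}$. -/

import Mathlib

noncomputable section

/-- A weighted oriented graph `D = (G, O, w)`: a simple graph `G`, an orientation of `G`
(every edge of `G` gets exactly one of its two directions; `arc x y` means `(x, y) ∈ E(D)`),
and a weight function with values in the positive integers. -/
structure WeightedOrientedGraph (V : Type*) where
  graph : SimpleGraph V
  arc : V → V → Prop
  adj_iff : ∀ x y, graph.Adj x y ↔ arc x y ∨ arc y x
  asymm : ∀ x y, arc x y → ¬ arc y x
  weight : V → ℕ
  weight_pos : ∀ x, 1 ≤ weight x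

namespace WeightedOrientedGraph

variable {V : Type*} (D : WeightedOrientedGraph V)

/-- The out-neighbourhood `N_D^+(x)`. -/
def outNeighborSet (x : V) : Set V := {y | D.arc x y}

/-- The in-neighbourhood `N_D^-(x)`. -/
def inNeighborSet (x : V) : Set V := {y | D.arc y x}

/-- A sink is a vertex without out-neighbours. -/
def IsSink (x : V) : Prop := D.outNeighborSet x = ∅

/-- A source is a vertex without in-neighbours. -/
def IsSource (x : V) : Prop := D.inNeighborSet x = ∅

/-- The set `V^+` of vertices of weight greater than `1`. -/
def VPlus : Set V := {x | 1 < D.weight x}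

/-- The edge ideal `I(D)`, generated by the `x_i * x_j ^ w(x_j)` with `(x_i, x_j) ∈ E(D)`. -/
def edgeIdeal (K : Type*) [Field K] : Ideal (MvPolynomial V K) :=
  Ideal.span {f | ∃ i j, D.arc i j ∧
    f = MvPolynomial.X i * MvPolynomial.X j ^ D.weight j}

end WeightedOrientedGraph

/-- An ideal `I` of a ring `R` is unmixed if all its associated primes (that is, the associated
primes of `R ⧸ I`) have the same height. -/
def IsUnmixedIdeal {R : Type*} [CommRing R] (I : Ideal R) : Prop :=
  ∀ p ∈ associatedPrimes R (R ⧸ I), ∀ q ∈ associatedPrimes R (R ⧸ I), p.height = q.height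

/-- The ten vertices of the graph `P10`. -/
inductive P10Vertex : Type
  | a1 | a2 | b1 | b2 | c1 | c2 | d1 | d2 | g1 | g2
  deriving DecidableEq

instance : Fintype P10Vertex where
  elems := {.a1, .a2, .b1, .b2, .c1, .c2, .d1, .d2, .g1, .g2}
  complete x := by cases x <;> decide

open P10Vertex in
/-- The graph `P10`: the two 5-cycles `a1 b1 d2 d1 g1` and `a2 b2 d1 d2 g2`, which share the
edge `d1 d2`, together with the path `g1 c1 c2 g2`. -/
def P10 : SimpleGraph P10Vertex :=
  SimpleGraph.fromEdgeSet
    {s(a1, b1), s(b1, d2), s(d2, d1), s(d1, b2), s(b2, a2), s(a1, g1), s(g1, d1),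
      s(g1, c1), s(c1, c2), s(c2, g2), s(g2, a2), s(d2, g2)}

end

/-! The associated primes of `I(D)` are exactly the ideals generated by the strong vertex covers
(`span_mem_associatedPrimes`, `exists_isStrongCover_of_mem_associatedPrimes`), and the height of
such a prime is the size of the cover. So unmixedness is a statement about cover sizes. Minimal
covers are strong, and those of `P10` all have six vertices. A vertex `y` violating condition 2
yields a strong cover with seven (`P10_exists_cover`): vertices with no neighbour outside it are
out-neighbours of `y`. Under condition 2 only `d1` and `d2` can play this role, and then every
strong cover is minimal (`P10_exists_neighbor_notMem`). -/

section

/-! ### Exponents of products -/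

open MvPolynomial

/-- If the exponents of `g * f` lie in an upper set that is saturated with respect to the variables
outside `C`, and `g` has a monomial in those variables, then the exponents of `f` lie in it. -/
theorem MvPolynomial.support_subset_of_mul_support_subset {σ R : Type*} [CommRing R] [NoZeroDivisors R]
    (C : Finset σ) {U : Set (σ →₀ ℕ)} (hU : IsUpperSet U)
    (hsat : ∀ n m : σ →₀ ℕ, (∀ i ∈ C, n i = 0) → n + m ∈ U → m ∈ U)
    {f g : MvPolynomial σ R} (hg : ∃ n ∈ g.support, ∀ i ∈ C, n i = 0)
    (hgf : ∀ k ∈ (g * f).support, k ∈ U) : ∀ m ∈ f.support, m ∈ U := by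
  classical
  by_contra! hf
  obtain ⟨m', hm', hm'U⟩ := hf
  obtain ⟨n', hn', hn'C⟩ := hg
  let _ : LinearOrder σ := linearOrderOfSTO WellOrderingRel
  -- Comparing degree in `C` first forces the least exponent of `g` to avoid `C`.
  let φ : (σ →₀ ℕ) → ℕ ×ₗ Lex (σ →₀ ℕ) := fun n => toLex (∑ i ∈ C, n i, toLex n)
  have hφadd : ∀ a b, φ (a + b) = φ a + φ b := by
    intro a b
    simp only [φ, Finsupp.add_apply, Finset.sum_add_distrib]
    rfl
  have hφinj : Function.Injective φ := by
    intro a b h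
    exact toLex.injective (congrArg Prod.snd (toLex.injective h))
  obtain ⟨n₀, hn₀, hn₀min⟩ := g.support.exists_min_image φ ⟨n', hn'⟩
  obtain ⟨m₀, hm₀, hm₀min⟩ := (f.support.filter (· ∉ U)).exists_min_image φ
    ⟨m', Finset.mem_filter.2 ⟨hm', hm'U⟩⟩
  rw [Finset.mem_filter] at hm₀
  have hn₀C : ∀ i ∈ C, n₀ i = 0 := by
    have h1 : ∑ i ∈ C, n₀ i ≤ ∑ i ∈ C, n' i := Prod.Lex.monotone_fst _ _ (hn₀min n' hn')
    rw [Finset.sum_eq_zero hn'C, Nat.le_zero, Finset.sum_eq_zero_iff] at h1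
    exact h1
  have hnot : n₀ + m₀ ∉ U := fun h => hm₀.2 (hsat _ _ hn₀C h)
  refine hnot (hgf _ ?_)
  -- No cancellation: a contributing pair has its second exponent outside `U`, so minimality of `n₀`
  -- and `m₀` forces equality.
  rw [mem_support_iff, coeff_mul, Finset.sum_eq_single (n₀, m₀)]
  · exact mul_ne_zero (mem_support_iff.1 hn₀) (mem_support_iff.1 hm₀.1)
  · rintro ⟨n, m⟩ hnm hne
    rw [Finset.HasAntidiagonal.mem_antidiagonal] at hnm
    by_contra hc
    have hn : n ∈ g.support := mem_support_iff.2 (left_ne_zero_of_mul hc)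
    have hm : m ∈ f.support := mem_support_iff.2 (right_ne_zero_of_mul hc)
    have hmU : m ∉ U := fun h => hnot (hnm ▸ hU (le_add_of_nonneg_left (zero_le)) h)
    have h := congrArg φ hnm
    rw [hφadd, hφadd, eq_comm, add_eq_add_iff_eq_and_eq (hn₀min n hn)
      (hm₀min m (Finset.mem_filter.2 ⟨hm, hmU⟩))] at h
    exact hne (Prod.ext (hφinj h.1).symm (hφinj h.2).symm)
  · intro h
    rw [Finset.HasAntidiagonal.mem_antidiagonal] at h
    exact absurd rfl h

/-! ### Primes generated by variables -/

section VariableIdeals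

variable {σ K : Type*} [Field K]

theorem MvPolynomial.not_mem_span_X_image_iff {C : Finset σ} {g : MvPolynomial σ K} :
    g ∉ Ideal.span (X '' (C : Set σ)) ↔ ∃ n ∈ g.support, ∀ i ∈ C, n i = 0 := by
  rw [mem_ideal_span_X_image]
  push Not
  simp

theorem MvPolynomial.X_mem_span_X_image_iff {C : Finset σ} {i : σ} :
    (X i : MvPolynomial σ K) ∈ Ideal.span (X '' (C : Set σ)) ↔ i ∈ C := by
  classical
  refine ⟨fun h => ?_, fun h => Ideal.subset_span ⟨i, h, rfl⟩⟩
  rw [mem_ideal_span_X_image] at h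
  obtain ⟨j, hj, hji⟩ := h (Finsupp.single i 1) (by simp [support_X])
  rw [Finsupp.single_apply] at hji
  split_ifs at hji with hij
  · exact hij ▸ hj
  · exact absurd rfl hji

theorem MvPolynomial.isPrime_span_X_image (C : Finset σ) :
    (Ideal.span (X '' (C : Set σ)) : Ideal (MvPolynomial σ K)).IsPrime := by
  refine ⟨?_, fun {g f} hgf => ?_⟩
  · rw [Ne, Ideal.eq_top_iff_one, not_mem_span_X_image_iff]
    exact ⟨0, by simp, by simp⟩
  · by_contra! h
    refine h.2 (mem_ideal_span_X_image.2 ?_)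
    refine support_subset_of_mul_support_subset (U := {m | ∃ i ∈ (C : Set σ), m i ≠ 0}) C ?_ ?_
      (not_mem_span_X_image_iff.1 h.1) (mem_ideal_span_X_image.1 hgf)
    · rintro a b hab ⟨i, hi, hai⟩
      exact ⟨i, hi, fun h0 => hai (Nat.le_zero.1 (h0 ▸ hab i))⟩
    · rintro n m hn ⟨i, hi, hne⟩
      exact ⟨i, hi, by simpa [hn i hi] using hne⟩

/-- Krull's height theorem bounds the height above; adding variables one at a time gives a strict
chain of primes. -/
theorem MvPolynomial.height_span_X_image [Finite σ] (C : Finset σ) :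
    (Ideal.span (X '' (C : Set σ)) : Ideal (MvPolynomial σ K)).height = C.card := by
  classical
  refine le_antisymm ?_ ?_
  · have h := (isPrime_span_X_image (K := K) C)
    have h2 := Ideal.height_le_card_of_mem_minimalPrimes_span (R := MvPolynomial σ K)
      (s := X '' (C : Set σ)) (p := Ideal.span (X '' (C : Set σ)))
      (C.finite_toSet.image X)
      (by rw [Ideal.minimalPrimes_eq_subsingleton_self]; rfl)
    rw [Set.ncard_image_of_injective _ X_injective] at h2
    simpa using h2
  · induction C using Finset.induction_on with
    | empty => simp
    | insert a s ha ih =>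
      have h1 := isPrime_span_X_image (K := K) s
      have h2 := isPrime_span_X_image (K := K) (insert a s)
      have hlt : (Ideal.span (X '' (s : Set σ)) : Ideal (MvPolynomial σ K)) <
          Ideal.span (X '' ((insert a s : Finset σ) : Set σ)) := by
        refine lt_of_le_of_ne (Ideal.span_mono (Set.image_mono (by simp))) fun h => ha ?_
        rw [← X_mem_span_X_image_iff (K := K), h, X_mem_span_X_image_iff]
        exact Finset.mem_insert_self a s
      rw [Finset.card_insert_of_notMem ha]
      rw [Nat.cast_add, Nat.cast_one]
      exact (add_le_add_left ih 1).trans (Ideal.height_add_one_le_of_lt_of_isPrime hlt)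

end VariableIdeals

end
-- Associated primes and strong covers
namespace WeightedOrientedGraph

section

open MvPolynomial

variable {V : Type*} (D : WeightedOrientedGraph V)

/-- The exponents of the monomials in the edge ideal of `D`. -/
def edgeIdealExponents : Set (V →₀ ℕ) :=
  {m | ∃ i j, D.arc i j ∧ 1 ≤ m i ∧ D.weight j ≤ m j}

/-- A strong vertex cover: a vertex cover `C` each of whose vertices either has a neighbour
outside `C`, or is an out-neighbour of a vertex of `C` which has weight at least two and
all of whose out-neighbours lie in `C`. -/
structure IsStrongCover (C : Finset V) : Prop where
  cover : ∀ i j, D.arc i j → i ∈ C ∨ j ∈ C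
  strong : ∀ x ∈ C, (∃ y ∉ C, D.graph.Adj x y) ∨
    ∃ y ∈ C, D.arc y x ∧ 1 < D.weight y ∧ ∀ z, D.arc y z → z ∈ C

theorem isUpperSet_edgeIdealExponents : IsUpperSet D.edgeIdealExponents := by
  rintro a b hab ⟨i, j, hij, hi, hj⟩
  exact ⟨i, j, hij, hi.trans (hab i), hj.trans (hab j)⟩

theorem mem_edgeIdeal_iff {K : Type*} [Field K] {f : MvPolynomial V K} :
    f ∈ D.edgeIdeal K ↔ ∀ m ∈ f.support, m ∈ D.edgeIdealExponents := by
  classical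
  have h : D.edgeIdeal K = Ideal.span ((fun m => monomial m (1 : K)) ''
      {m | ∃ i j, D.arc i j ∧ m = Finsupp.single i 1 + Finsupp.single j (D.weight j)}) := by
    refine congrArg Ideal.span (Set.ext fun f => ⟨?_, ?_⟩)
    · rintro ⟨i, j, hij, rfl⟩
      refine ⟨_, ⟨i, j, hij, rfl⟩, ?_⟩
      simp [X, monomial_pow, monomial_mul]
    · rintro ⟨_, ⟨i, j, hij, rfl⟩, rfl⟩
      refine ⟨i, j, hij, ?_⟩
      simp [X, monomial_pow, monomial_mul]
  rw [h, mem_ideal_span_monomial_image]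
  refine forall₂_congr fun m _ => ⟨?_, ?_⟩
  · rintro ⟨_, ⟨i, j, hij, rfl⟩, hle⟩
    refine ⟨i, j, hij, le_trans ?_ (hle i), le_trans ?_ (hle j)⟩ <;> simp
  · rintro ⟨i, j, hij, hi, hj⟩
    refine ⟨_, ⟨i, j, hij, rfl⟩, fun k => ?_⟩
    have hne : i ≠ j := by rintro rfl; exact D.asymm _ _ hij hij
    by_cases hki : i = k
    · subst hki
      simpa [hne.symm] using hi
    · by_cases hkj : j = k
      · subst hkj
        simpa [hki] using hj
      · simp [hki, hkj]

theorem isAssociatedPrime_edgeIdeal_iff [Finite V] {K : Type*} [Field K]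
    {p : Ideal (MvPolynomial V K)} :
    IsAssociatedPrime p (MvPolynomial V K ⧸ D.edgeIdeal K) ↔
      p.IsPrime ∧ ∃ f, ∀ g, g ∈ p ↔ g * f ∈ D.edgeIdeal K := by
  rw [IsAssociatedPrime, Submodule.isAssociatedPrime_iff]
  refine and_congr_right fun _ => ?_
  rw [(Ideal.Quotient.mk_surjective (I := D.edgeIdeal K)).exists]
  refine exists_congr fun f => ?_
  rw [SetLike.ext_iff]
  refine forall_congr' fun g => iff_congr Iff.rfl ?_
  rw [Submodule.mem_colon_singleton, Submodule.mem_bot, ← Ideal.Quotient.eq_zero_iff_mem, map_mul]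
  rfl

variable {D}

/-- A strong vertex cover generates an associated prime of the edge ideal. -/
theorem IsStrongCover.span_mem_associatedPrimes [Finite V] {C : Finset V} (hC : D.IsStrongCover C)
    (K : Type*) [Field K] :
    Ideal.span (X '' (C : Set V)) ∈
      associatedPrimes (MvPolynomial V K) (MvPolynomial V K ⧸ D.edgeIdeal K) := by
  classical
  -- The largest useful exponents: full weight off `C`, one short of it inside, and zero where an
  -- arc leaves `C`. No generator then divides `m`, even after multiplying by variables outside `C`,
  -- while any variable in `C` completes one.
  let m : V →₀ ℕ := Finsupp.equivFunOnFinite.symm fun x =>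
    if x ∈ C then if ∃ j ∉ C, D.arc x j then 0 else D.weight x - 1 else D.weight x
  have hm : ∀ x, m x =
      if x ∈ C then if ∃ j ∉ C, D.arc x j then 0 else D.weight x - 1 else D.weight x :=
    fun _ => rfl
  have hout : ∀ x ∉ C, m x = D.weight x := fun x hx => by rw [hm, if_neg hx]
  have hzero : ∀ x ∈ C, ∀ j ∉ C, D.arc x j → m x = 0 := fun x hx j hj hxj => by
    rw [hm, if_pos hx, if_pos ⟨j, hj, hxj⟩]
  have hpred : ∀ x ∈ C, (∀ j, D.arc x j → j ∈ C) → m x = D.weight x - 1 := fun x hx hxj => by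
    rw [hm, if_pos hx, if_neg]
    rintro ⟨j, hj, h⟩
    exact hj (hxj j h)
  have hlt : ∀ x ∈ C, m x < D.weight x := fun x hx => by
    have := D.weight_pos x
    rw [hm, if_pos hx]
    split_ifs <;> omega
  have hnot : ∀ n : V →₀ ℕ, (∀ i ∈ C, n i = 0) → n + m ∉ D.edgeIdealExponents := by
    rintro n hn ⟨i, j, hij, hi, hj⟩
    rw [Finsupp.add_apply] at hi hj
    have hjC : j ∉ C := fun hjC => by
      have := hlt j hjC
      rw [hn j hjC] at hj
      omega
    have hiC : i ∈ C := (hC.cover i j hij).resolve_right hjC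
    rw [hn i hiC, hzero i hiC j hjC hij] at hi
    omega
  have hmem : ∀ x ∈ C, Finsupp.single x 1 + m ∈ D.edgeIdealExponents := by
    intro x hx
    have hself : 1 ≤ (Finsupp.single x 1 + m : V →₀ ℕ) x := by simp
    by_cases h1 : ∃ j ∉ C, D.arc x j
    · obtain ⟨j, hj, hxj⟩ := h1
      exact ⟨x, j, hxj, hself, by rw [Finsupp.add_apply, hout j hj]; omega⟩
    · push Not at h1
      have hw : D.weight x ≤ (Finsupp.single x 1 + m : V →₀ ℕ) x := by
        rw [Finsupp.add_apply, hpred x hx fun j hj => by_contra fun h => h1 j h hj,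
          Finsupp.single_eq_same]
        omega
      rcases hC.strong x hx with ⟨y, hy, hxy⟩ | ⟨y, hy, hyx, hwy, hyC⟩
      · have hyx : D.arc y x := ((D.adj_iff x y).1 hxy).resolve_left (h1 y hy)
        refine ⟨y, x, hyx, ?_, hw⟩
        have := D.weight_pos y
        rw [Finsupp.add_apply, hout y hy]
        omega
      · refine ⟨y, x, hyx, ?_, hw⟩
        rw [Finsupp.add_apply, hpred y hy hyC]
        omega
  refine D.isAssociatedPrime_edgeIdeal_iff.2
    ⟨isPrime_span_X_image C, monomial m 1, fun g => ⟨fun hg => ?_, fun hg => ?_⟩⟩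
  · rw [mem_ideal_span_X_image] at hg
    refine D.mem_edgeIdeal_iff.2 fun k hk => ?_
    rw [mem_support_iff, coeff_mul_monomial', mul_one] at hk
    split_ifs at hk with hmk
    · obtain ⟨x, hx, hx0⟩ := hg _ (mem_support_iff.2 hk)
      refine D.isUpperSet_edgeIdealExponents ?_ (hmem x hx)
      rw [← tsub_add_cancel_of_le hmk]
      exact add_le_add_left (Finsupp.single_le_iff.2 (Nat.one_le_iff_ne_zero.2 hx0)) m
    · exact absurd rfl hk
  · by_contra h
    obtain ⟨n, hn, hnC⟩ := not_mem_span_X_image_iff.1 h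
    refine hnot n hnC (D.mem_edgeIdeal_iff.1 hg _ ?_)
    rw [mem_support_iff, coeff_mul_monomial, mul_one]
    exact mem_support_iff.1 hn

/-- Every associated prime of the edge ideal is generated by a strong vertex cover. -/
theorem exists_isStrongCover_of_mem_associatedPrimes [Finite V] {K : Type*} [Field K]
    {p : Ideal (MvPolynomial V K)}
    (hp : p ∈ associatedPrimes (MvPolynomial V K) (MvPolynomial V K ⧸ D.edgeIdeal K)) :
    ∃ C : Finset V, D.IsStrongCover C ∧ p = Ideal.span (X '' (C : Set V)) := by
  classical
  have := Fintype.ofFinite V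
  obtain ⟨hprime, f, hf⟩ := D.isAssociatedPrime_edgeIdeal_iff.1 hp
  let C : Finset V := Finset.univ.filter fun x => X x ∈ p
  have hCmem : ∀ x, x ∈ C ↔ X x ∈ p := fun x => by simp [C]
  -- As `p` is prime, multiplying by this monomial does not affect membership in `p`; it makes the
  -- exponents off `C` irrelevant.
  let u : V →₀ ℕ := Finsupp.equivFunOnFinite.symm fun x => if x ∈ C then 0 else D.weight x
  have hu : ∀ x ∉ C, u x = D.weight x := fun x hx => if_neg hx
  have hup : monomial u (1 : K) ∉ p := by
    rw [monomial_eq, C_1, one_mul, Finsupp.prod_fintype _ _ (fun i => pow_zero _)]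
    intro h
    obtain ⟨x, -, hx⟩ := (hprime.prod_mem_iff).1 h
    by_cases hxC : x ∈ C
    · have : u x = 0 := if_pos hxC
      rw [this, pow_zero] at hx
      exact hprime.ne_top ((Ideal.eq_top_iff_one _).2 hx)
    · exact hxC ((hCmem x).2 (hprime.mem_of_pow_mem _ hx))
  -- the exponents `k` with `u + k` in the ideal form a set saturated off `C`
  let U : Set (V →₀ ℕ) := {k | u + k ∈ D.edgeIdealExponents}
  have hUup : IsUpperSet U := fun a b hab ha =>
    D.isUpperSet_edgeIdealExponents (add_le_add_right hab u) ha
  have hsat : ∀ n k : V →₀ ℕ, (∀ i ∈ C, n i = 0) → n + k ∈ U → k ∈ U := by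
    rintro n k hn ⟨i, j, hij, hi, hj⟩
    refine ⟨i, j, hij, ?_, ?_⟩
    · by_cases hiC : i ∈ C
      · simpa [hn i hiC] using hi
      · have := D.weight_pos i
        rw [Finsupp.add_apply, hu i hiC]
        omega
    · by_cases hjC : j ∈ C
      · simpa [hn j hjC] using hj
      · rw [Finsupp.add_apply, hu j hjC]
        omega
  have hmul : ∀ g, g ∈ p ↔ ∀ k ∈ (g * f).support, k ∈ U := by
    intro g
    have : g ∈ p ↔ monomial u 1 * g ∈ p :=
      ⟨fun h => p.mul_mem_left _ h, fun h => (hprime.mem_or_mem h).resolve_left hup⟩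
    rw [this, hf, mem_edgeIdeal_iff, mul_assoc]
    constructor
    · intro h k hk
      refine h (u + k) ?_
      rw [mem_support_iff, coeff_monomial_mul, one_mul]
      exact mem_support_iff.1 hk
    · intro h k hk
      rw [mem_support_iff, coeff_monomial_mul', one_mul] at hk
      split_ifs at hk with huk
      · have := h _ (mem_support_iff.2 hk)
        rwa [Set.mem_ofPred_eq, add_tsub_cancel_of_le huk] at this
      · exact absurd rfl hk
  have hpC : p = Ideal.span (X '' (C : Set V)) := by
    refine le_antisymm (fun g hg => ?_) (Ideal.span_le.2 ?_)
    · by_contra hgC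
      have h := support_subset_of_mul_support_subset C hUup hsat
        (not_mem_span_X_image_iff.1 hgC) ((hmul g).1 hg)
      exact hprime.ne_top ((Ideal.eq_top_iff_one _).2 ((hmul 1).2 (by rwa [one_mul])))
    · rintro _ ⟨x, hx, rfl⟩
      exact (hCmem x).1 hx
  obtain ⟨m, hm, hmU⟩ : ∃ m ∈ f.support, m ∉ U := by
    by_contra! h
    exact hprime.ne_top ((Ideal.eq_top_iff_one _).2 ((hmul 1).2 (by rwa [one_mul])))
  have hxm : ∀ x ∈ C, Finsupp.single x 1 + m ∈ U := by
    intro x hx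
    refine (hmul (X x)).1 ((hCmem x).1 hx) _ ?_
    rw [mem_support_iff, coeff_X_mul]
    exact mem_support_iff.1 hm
  have hnot : ∀ i j, D.arc i j → 1 ≤ (u + m) i → ¬ D.weight j ≤ (u + m) j :=
    fun i j hij hi hj => hmU ⟨i, j, hij, hi, hj⟩
  have hbig : ∀ x ∉ C, D.weight x ≤ (u + m) x := fun x hx => by
    rw [Finsupp.add_apply, hu x hx]
    omega
  -- The generator that appears on multiplying by `x` must involve `x`, as tail or as head.
  have hedge : ∀ x ∈ C, (∃ j, D.arc x j ∧ (u + m) x = 0 ∧ D.weight j ≤ (u + m) j) ∨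
      ∃ i, D.arc i x ∧ 1 ≤ (u + m) i ∧ D.weight x = (u + m) x + 1 := by
    intro x hx
    obtain ⟨i, j, hij, hi, hj⟩ := hxm x hx
    have hne : i ≠ j := by rintro rfl; exact D.asymm _ _ hij hij
    rw [add_left_comm, Finsupp.add_apply] at hi hj
    by_cases hix : x = i
    · subst hix
      rw [Finsupp.single_eq_of_ne hne.symm, zero_add] at hj
      refine Or.inl ⟨j, hij, ?_, hj⟩
      by_contra h
      exact hnot _ _ hij (Nat.one_le_iff_ne_zero.2 h) hj
    · rw [Finsupp.single_eq_of_ne (Ne.symm hix), zero_add] at hi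
      have hjn := hnot _ _ hij hi
      by_cases hjx : x = j
      · subst hjx
        rw [Finsupp.single_eq_same] at hj
        exact Or.inr ⟨i, hij, hi, by omega⟩
      · rw [Finsupp.single_eq_of_ne (Ne.symm hjx), zero_add] at hj
        exact absurd hj hjn
  refine ⟨C, ⟨fun i j hij => ?_, fun x hx => ?_⟩, hpC⟩
  · by_contra! h
    exact hnot i j hij ((D.weight_pos i).trans (hbig i h.1)) (hbig j h.2)
  · by_contra! h
    obtain ⟨hN, hS⟩ := h
    -- By `hedge`, exponents on `C` are zero or weight minus one. This excludes a head `j` in `C`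
    -- with full weight, and makes a tail `i` in `C` with positive exponent have weight at least
    -- two.
    rcases hedge x hx with ⟨j, hxj, hx0, hj⟩ | ⟨i, hix, hi, hx1⟩
    · have hjC : j ∈ C := by_contra fun hjC => hN j hjC ((D.adj_iff x j).2 (Or.inl hxj))
      have := D.weight_pos j
      rcases hedge j hjC with ⟨k, -, hj0, -⟩ | ⟨k, -, -, hj1⟩ <;> omega
    · have hiC : i ∈ C := by_contra fun hiC => hN i hiC ((D.adj_iff x i).2 (Or.inr hix))
      have hiw : 1 < D.weight i := by
        rcases hedge i hiC with ⟨k, -, hi0, -⟩ | ⟨k, -, -, hi1⟩ <;> omega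
      obtain ⟨k, hik, hkC⟩ := hS i hiC hix hiw
      exact hnot i k hik hi (hbig k hkC)

end

end WeightedOrientedGraph
-- Vertex covers of `P10`
section

open P10Vertex

/-- The neighbours of a vertex of `P10`. -/
def P10Vertex.neighbors : P10Vertex → Finset P10Vertex
  | a1 => {b1, g1}
  | a2 => {b2, g2}
  | b1 => {a1, d2}
  | b2 => {a2, d1}
  | c1 => {c2, g1}
  | c2 => {c1, g2}
  | d1 => {d2, b2, g1}
  | d2 => {d1, b1, g2}
  | g1 => {a1, d1, c1}
  | g2 => {a2, d2, c2}

theorem P10_adj_iff {x y : P10Vertex} : P10.Adj x y ↔ y ∈ x.neighbors := by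
  simp only [P10, SimpleGraph.fromEdgeSet_adj, Set.mem_insert_iff, Set.mem_singleton_iff]
  revert x y
  decide +kernel

/-- Every minimal vertex cover of `P10` has six vertices. -/
theorem P10_card_minimal_cover : ∀ C : Finset P10Vertex,
    (∀ x, ∀ y ∈ x.neighbors, x ∈ C ∨ y ∈ C) → (∀ x ∈ C, ∃ y ∈ x.neighbors, y ∉ C) →
      C.card = 6 := by
  decide +kernel

set_option synthInstance.maxHeartbeats 400000 in
set_option synthInstance.maxSize 1000 in
/-- For a proper nonempty set `A` of neighbours of `y`, up to two exceptions, `P10` has a vertex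
cover with seven vertices which contains `y` and `A` and whose vertices outside `A` all have a
neighbour outside the cover. -/
theorem P10_exists_cover : ∀ y : P10Vertex, ∀ A ∈ y.neighbors.powerset, A ≠ ∅ →
    A ≠ y.neighbors → ¬ (y = d1 ∧ A = {g1, b2}) → ¬ (y = d2 ∧ A = {g2, b1}) →
    -- Complements of independent triples; these twelve suffice, which keeps the decision small.
    ∃ C ∈ ([Finset.univ \ {b2, g2, g1}, Finset.univ \ {b2, b1, c2}, Finset.univ \ {g2, b1, g1},
        Finset.univ \ {c1, b2, b1}, Finset.univ \ {a2, c1, d2}, Finset.univ \ {b2, a1, c2},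
        Finset.univ \ {d1, a1, c2}, Finset.univ \ {a2, c1, b1}, Finset.univ \ {a2, b1, g1},
        Finset.univ \ {b2, g2, a1}, Finset.univ \ {g2, b1, d1}, Finset.univ \ {d2, b2, g1}] :
        List (Finset P10Vertex)),
      (∀ x, ∀ z ∈ x.neighbors, x ∈ C ∨ z ∈ C) ∧ y ∈ C ∧ A ⊆ C ∧
      (∀ x ∈ C, (∃ z ∈ x.neighbors, z ∉ C) ∨ x ∈ A) ∧ C.card = 7 := by
  decide +kernel

end

/-- The edge ideal of a weighted oriented graph is unmixed if and only if all its strong vertex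
covers have the same cardinality. -/
theorem isUnmixedIdeal_edgeIdeal_iff {V K : Type*} [Finite V] [Field K]
    (D : WeightedOrientedGraph V) :
    IsUnmixedIdeal (D.edgeIdeal K) ↔
      ∀ C C' : Finset V, D.IsStrongCover C → D.IsStrongCover C' → C.card = C'.card := by
  constructor
  · intro h C C' hC hC'
    have := h _ (hC.span_mem_associatedPrimes K) _ (hC'.span_mem_associatedPrimes K)
    rw [MvPolynomial.height_span_X_image, MvPolynomial.height_span_X_image] at this
    exact_mod_cast this
  · intro h p hp q hq
    obtain ⟨C, hC, rfl⟩ := WeightedOrientedGraph.exists_isStrongCover_of_mem_associatedPrimes hp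
    obtain ⟨C', hC', rfl⟩ := WeightedOrientedGraph.exists_isStrongCover_of_mem_associatedPrimes hq
    rw [MvPolynomial.height_span_X_image, MvPolynomial.height_span_X_image, h C C' hC hC']

set_option synthInstance.maxHeartbeats 400000 in
set_option synthInstance.maxSize 1000 in
open P10Vertex in
/-- In a vertex cover `C` of `P10`, some vertex whose neighbours all lie in `C` is neither one of
`g1`, `b2` with `d1`, `g1`, `b2` in `C` nor one of `g2`, `b1` with `d2`, `g2`, `b1` in `C`,
unless no vertex of `C` has all its neighbours in `C`. -/
theorem P10_exists_neighbor_notMem : ∀ C : Finset P10Vertex,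
    (∀ x, ∀ y ∈ x.neighbors, x ∈ C ∨ y ∈ C) →
    (∀ x ∈ C, (∃ y ∈ x.neighbors, y ∉ C) ∨
      ((x = g1 ∨ x = b2) ∧ d1 ∈ C ∧ g1 ∈ C ∧ b2 ∈ C) ∨
      ((x = g2 ∨ x = b1) ∧ d2 ∈ C ∧ g2 ∈ C ∧ b1 ∈ C)) →
    ∀ x ∈ C, ∃ y ∈ x.neighbors, y ∉ C := by
  decide +kernel

theorem mainTheorem11 {K : Type*} [Field K] (D : WeightedOrientedGraph P10Vertex)
    (hG : D.graph = P10) (hsource : ∀ x, D.IsSource x → D.weight x = 1) :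
    IsUnmixedIdeal (D.edgeIdeal K) ↔
      ∀ y ∈ D.VPlus, ¬ D.IsSink y →
        (y = P10Vertex.d1 ∧ D.outNeighborSet y = {P10Vertex.g1, P10Vertex.b2}) ∨
        (y = P10Vertex.d2 ∧ D.outNeighborSet y = {P10Vertex.g2, P10Vertex.b1}) := by
  classical
  have hadj : ∀ x y, D.graph.Adj x y ↔ y ∈ x.neighbors := fun x y => by rw [hG, P10_adj_iff]
  have harc : ∀ x y, D.arc x y → y ∈ x.neighbors := fun x y h =>
    (hadj x y).1 ((D.adj_iff x y).2 (Or.inl h))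
  have hcover : ∀ {C : Finset P10Vertex},
      (∀ i j, D.arc i j → i ∈ C ∨ j ∈ C) ↔ ∀ x, ∀ y ∈ x.neighbors, x ∈ C ∨ y ∈ C := by
    refine ⟨fun h x y hxy => ?_, fun h i j hij => h i j (harc i j hij)⟩
    rcases (D.adj_iff x y).1 ((hadj x y).2 hxy) with h' | h'
    · exact h x y h'
    · exact (h y x h').symm
  rw [isUnmixedIdeal_edgeIdeal_iff]
  constructor
  · intro h y hy hsink
    by_contra hex
    rw [not_or] at hex
    let A : Finset P10Vertex := Finset.univ.filter (D.arc y)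
    have hA : ∀ z, z ∈ A ↔ D.arc y z := fun z => by simp [A]
    have hAset : (A : Set P10Vertex) = D.outNeighborSet y := Set.ext hA
    have hne : A ≠ ∅ := fun h0 => hsink (by rw [WeightedOrientedGraph.IsSink, ← hAset, h0]; simp)
    -- Otherwise `y` would be a source, hence of weight one.
    have hne' : A ≠ y.neighbors := fun h0 => by
      have hw : D.weight y = 1 := hsource y <| Set.eq_empty_iff_forall_notMem.2 fun z hz =>
        D.asymm z y hz <| (hA z).1 <| h0 ▸
          (hadj y z).1 ((D.adj_iff y z).2 (Or.inr hz))
      exact absurd hw (ne_of_gt hy)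
    obtain ⟨C, -, hC, hyC, hAC, hdom, hcard⟩ := P10_exists_cover y A
      (Finset.mem_powerset.2 fun z hz => harc y z ((hA z).1 hz)) hne hne'
      (fun h0 => hex.1 ⟨h0.1, by rw [← hAset, h0.2]; simp⟩)
      (fun h0 => hex.2 ⟨h0.1, by rw [← hAset, h0.2]; simp⟩)
    have hC7 : D.IsStrongCover C := by
      refine ⟨hcover.2 hC, fun x hx => ?_⟩
      rcases hdom x hx with ⟨z, hz, hzC⟩ | hxA
      · exact Or.inl ⟨z, hzC, (hadj x z).2 hz⟩
      · exact Or.inr ⟨y, hyC, (hA x).1 hxA, hy, fun z hz => hAC ((hA z).2 hz)⟩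
    obtain ⟨C', hC', hdom', hcard'⟩ : ∃ C : Finset P10Vertex,
        (∀ x, ∀ y ∈ x.neighbors, x ∈ C ∨ y ∈ C) ∧ (∀ x ∈ C, ∃ y ∈ x.neighbors, y ∉ C) ∧
          C.card = 6 :=
      ⟨{.a1, .a2, .c1, .c2, .d1, .d2}, by decide +kernel⟩
    have hC6 : D.IsStrongCover C' :=
      ⟨hcover.2 hC', fun x hx => Or.inl <|
        let ⟨z, hz, hzC⟩ := hdom' x hx
        ⟨z, hzC, (hadj x z).2 hz⟩⟩
    have := h C C' hC7 hC6
    omega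
  · intro h
    have hsix : ∀ C : Finset P10Vertex, D.IsStrongCover C → C.card = 6 := by
      intro C hC
      have hC' := hcover.1 hC.cover
      -- Condition 2 makes `C` minimal, since only `d1` and `d2` can justify a vertex with no
      -- neighbour outside `C`.
      refine P10_card_minimal_cover C hC' (P10_exists_neighbor_notMem C hC' fun x hx => ?_)
      rcases hC.strong x hx with ⟨z, hz, hxz⟩ | ⟨y, hyC, hyx, hw, hout⟩
      · exact Or.inl ⟨z, (hadj x z).1 hxz, hz⟩
      · have hx' : x ∈ D.outNeighborSet y := hyx
        have hsub : ∀ z ∈ D.outNeighborSet y, z ∈ C := hout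
        right
        rcases h y hw (fun h0 => by rw [h0] at hx'; exact hx') with ⟨rfl, hN⟩ | ⟨rfl, hN⟩
        · rw [hN] at hx' hsub
          exact Or.inl ⟨hx', hyC, hsub _ (by simp), hsub _ (by simp)⟩
        · rw [hN] at hx' hsub
          exact Or.inr ⟨hx', hyC, hsub _ (by simp), hsub _ (by simp)⟩
    intro C C' hC hC'
    rw [hsix C hC, hsix C' hC']
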